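/- Let $R$ be an associative ring with identity and let $M$ be a nonzero left $R$-module that is projective in $\sigma[M]$, the full subcategory of $R$-Mod whose objects are the modules that embed in a quotient of a direct sum of copies of $M$. A submodule $N\le M$ is fully invariant if $f(N)\subseteq N$ for all $f\in\operatorname{End}_R(M)$; let $\Lambda^{fi}(M)$ be the set of fully invariant submodules of $M$. For $N,K\le M$ put $$N_MK=\sum\{f(N)\mid f\in\operatorname{Hom}_R(M,K)\},\qquad \operatorname{Ann}_M(K)=\bigcap\{\ker f\mid f\in\operatorname{Hom}_R(M,K)\}.$$ A proper $P\in\Lambda^{fi}(M)$ is prime if $L_MK\le P$ with $L,K\in\Lambda^{fi}(M)$ implies $L\le P$ or $K\le P$, and a proper $N\in\Lambda^{fi}(M)$ is semiprime if $L_ML\le N$ with $L\in\Lambda^{fi}(M)$ implies $L\le N$. The module $M$ is semiprime if $0$ is a semiprime submodule; $M$ is FI-retractable if $\operatorname{Hom}_R(M,K)\ne 0$ for every nonzero $K\in\Lambda^{fi}(M)$; $M$ is FI-Baer if $\operatorname{Ann}_M(N)$ is a direct summand of $M$ for every $N\in\Lambda^{fi}(M)$. $\operatorname{Spec}(M)$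 is the set of prime submodules of $M$ with the topology whose open sets are $\{P\mid N\not\le P\}$, $N\in\Lambda^{fi}(M)$; a space is extremely disconnected if the closure of every open set is open. $SP(M)$ is the frame (ordered by inclusion) consisting of the semiprime submodules of $M$ together with $M$; in a frame, $\neg a=\bigvee\{x\mid x\wedge a=0\}$, and the frame satisfies DML if $\neg(a\wedge b)=\neg a\vee\neg b$ for all $a,b$. The following conditions are equivalent: 1. $M$ is semiprime and $\operatorname{Ann}_M(N\cap L)=\operatorname{Ann}_M(N)+\operatorname{Ann}_M(L)$ for all $N,L\in\Lambda^{fi}(M)$. 2. $M$ is FI-retractable and $\operatorname{Ann}_M(N_ML)=\operatorname{Ann}_M(N)+\operatorname{Ann}_M(L)$ for all $N,L\in\Lambda^{fi}(M)$. 3. $M$ is FI-retractable and $M=\operatorname{Ann}_M(N)\oplus\operatorname{Ann}_M(\operatorname{Ann}_M(N))$ for all $N\in\Lambda^{fi}(M)$. 4. $M$ is FI-retractable and FI-Baer, and for every $N\in\Lambda^{fi}(M)$ and every decomposition $M=\operatorname{Ann}_M(N)\oplus L$ the projection of $M$ onto $\operatorname{Ann}_M(N)$ along $L$ is a central idempotent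 of $\operatorname{End}_R(M)$. 5. $M$ is semiprime and the frame $SP(M)$ satisfies DML. 6. $M$ is semiprime and $\operatorname{Spec}(M)$ is extremely disconnected. -/

import Mathlib

namespace FIMod

universe u v

section Sigma

variable (R : Type u) [Ring R] (M : Type v) [AddCommGroup M] [Module R M]

/-- `N` is `M`-generated: there is an epimorphism from a direct sum of copies of `M` onto `N`. -/
def IsGenerated (N : Type v) [AddCommGroup N] [Module R N] : Prop :=
  ∃ (X : Type v) (ρ : (X →₀ M) →ₗ[R] N), Function.Surjective ρ

/-- `N` is an object of `σ[M]`: it embeds in an `M`-generated module. -/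
def IsSubgenerated (N : Type v) [AddCommGroup N] [Module R N] : Prop :=
  ∃ (K : Type v) (_ : AddCommGroup K) (_ : Module R K),
    IsGenerated R M K ∧ ∃ i : N →ₗ[R] K, Function.Injective i

/-- `M` is projective in `σ[M]`: maps out of `M` lift along every epimorphism `A → B` of `σ[M]`.
(The class of modules in `σ[M]` is closed under quotients, so `B` is in `σ[M]` when `A` is.) -/
def IsProjectiveInSigma : Prop :=
  ∀ (A B : Type v) [AddCommGroup A] [Module R A] [AddCommGroup B] [Module R B],
    IsSubgenerated R M A →
    ∀ (g : A →ₗ[R] B) (f : M →ₗ[R] B), Function.Surjective g →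
      ∃ h : M →ₗ[R] A, g ∘ₗ h = f

end Sigma

section Product

variable {R : Type u} [Ring R] {M : Type v} [AddCommGroup M] [Module R M]

/-- The product `N_M K = ∑ {f(N) | f ∈ Hom_R(M, K)}` of two submodules of `M`, as a submodule
of `M`. -/
def prod (N K : Submodule R M) : Submodule R M :=
  ⨆ f : M →ₗ[R] K, N.map (K.subtype ∘ₗ f)

/-- The annihilator `Ann_M(K) = ⋂ {Ker f | f ∈ Hom_R(M, K)}`. -/
def ann (K : Submodule R M) : Submodule R M :=
  ⨅ f : M →ₗ[R] K, LinearMap.ker f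

/-- `P` is a prime submodule in `M`. -/
def IsPrimeIn (P : Submodule R M) : Prop :=
  P ≠ ⊤ ∧ P.IsFullyInvariant ∧
    ∀ L K : Submodule R M, L.IsFullyInvariant → K.IsFullyInvariant →
      prod L K ≤ P → L ≤ P ∨ K ≤ P

/-- `N` is a semiprime submodule in `M`. -/
def IsSemiprimeIn (N : Submodule R M) : Prop :=
  N ≠ ⊤ ∧ N.IsFullyInvariant ∧
    ∀ L : Submodule R M, L.IsFullyInvariant → prod L L ≤ N → L ≤ N

theorem prod_mono {N N' K K' : Submodule R M} (hN : N ≤ N') (hK : K ≤ K') :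
    prod N K ≤ prod N' K' := by
  refine iSup_le fun f => ?_
  refine le_trans ?_ (le_iSup (fun g : M →ₗ[R] K' => N'.map (K'.subtype ∘ₗ g))
    (Submodule.inclusion hK ∘ₗ f))
  rintro _ ⟨x, hx, rfl⟩
  exact ⟨x, hN hx, rfl⟩

theorem isFullyInvariant_inf {N L : Submodule R M} (hN : N.IsFullyInvariant)
    (hL : L.IsFullyInvariant) : (N ⊓ L).IsFullyInvariant :=
  fun f _ hx => ⟨hN f hx.1, hL f hx.2⟩

theorem isFullyInvariant_sSup {S : Set (Submodule R M)}
    (h : ∀ N ∈ S, N.IsFullyInvariant) : (sSup S).IsFullyInvariant :=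
  fun f => sSup_le fun N hN => (h N hN f).trans (Submodule.comap_mono (le_sSup hN))

theorem isFullyInvariant_sInf {S : Set (Submodule R M)}
    (h : ∀ N ∈ S, N.IsFullyInvariant) : (sInf S).IsFullyInvariant := by
  intro f x hx
  rw [Submodule.mem_comap, Submodule.mem_sInf]
  exact fun N hN => h N hN f ((Submodule.mem_sInf.1 hx) N hN)

end Product

section ModuleProperties

variable (R : Type u) [Ring R] (M : Type v) [AddCommGroup M] [Module R M]

/-- `M` is a semiprime module. -/
def IsSemiprimeModule : Prop :=
  IsSemiprimeIn (⊥ : Submodule R M)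

/-- `M` satisfies the algebraic De Morgan law. -/
def SatisfiesDML : Prop :=
  ∀ N L : Submodule R M, N.IsFullyInvariant → L.IsFullyInvariant →
    ann (N ⊓ L) = ann N ⊔ ann L

/-- `M` is FI-retractable. -/
def IsFIRetractable : Prop :=
  ∀ K : Submodule R M, K.IsFullyInvariant → K ≠ ⊥ → ∃ f : M →ₗ[R] K, f ≠ 0

/-- `M` is FI-Baer: `Ann_M(N)` is a direct summand for every fully invariant `N`. -/
def IsFIBaer : Prop :=
  ∀ N : Submodule R M, N.IsFullyInvariant → ∃ L : Submodule R M, IsCompl (ann N) L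

/-- The prime spectrum `Spec(M)`. -/
def Spec : Type v :=
  {P : Submodule R M // IsPrimeIn P}

/-- The topology of `Spec(M)`: its open sets are the `U(N) = {P | N ≰ P}` with `N` fully
invariant. -/
instance : TopologicalSpace (Spec R M) where
  IsOpen U := ∃ N : Submodule R M, N.IsFullyInvariant ∧ U = {P : Spec R M | ¬ N ≤ P.1}
  isOpen_univ := by
    refine ⟨⊤, fun f => by simp, ?_⟩
    ext P
    simpa using P.2.1
  isOpen_inter := by
    rintro _ _ ⟨N, hN, rfl⟩ ⟨L, hL, rfl⟩
    refine ⟨N ⊓ L, isFullyInvariant_inf hN hL, ?_⟩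
    ext P
    simp only [Set.mem_inter_iff, Set.mem_ofPred_eq]
    constructor
    · rintro ⟨h1, h2⟩ h
      have hp : prod N L ≤ P.1 := by
        refine le_trans (le_inf ?_ ?_) h
        · exact iSup_le fun f => Submodule.map_le_iff_le_comap.2 (hN (L.subtype ∘ₗ f))
        · refine iSup_le fun f => ?_
          rintro _ ⟨x, _, rfl⟩
          exact (f x).2
      rcases P.2.2.2 N L hN hL hp with h' | h'
      · exact h1 h'
      · exact h2 h'
    · exact fun h => ⟨fun h' => h (inf_le_left.trans h'), fun h' => h (inf_le_right.trans h')⟩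
  isOpen_sUnion := by
    intro S hS
    refine ⟨sSup {N | N.IsFullyInvariant ∧ {P : Spec R M | ¬ N ≤ P.1} ∈ S},
      isFullyInvariant_sSup fun N hN => hN.1, ?_⟩
    ext P
    simp only [Set.mem_sUnion, Set.mem_ofPred_eq, sSup_le_iff, not_forall]
    constructor
    · rintro ⟨U, hU, hP⟩
      obtain ⟨N, hN, rfl⟩ := hS U hU
      exact ⟨N, ⟨hN, hU⟩, hP⟩
    · rintro ⟨N, ⟨_, hU⟩, hP⟩
      exact ⟨_, hU, hP⟩

/-- The set `SP(M)` of the semiprime submodules of `M`, together with `M` itself as its greatest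
element, ordered by inclusion. -/
def SP : Type v :=
  {N : Submodule R M // IsSemiprimeIn N ∨ N = ⊤}

instance : PartialOrder (SP R M) :=
  inferInstanceAs (PartialOrder {N : Submodule R M // IsSemiprimeIn N ∨ N = ⊤})

theorem sInf_mem_SP (S : Set (Submodule R M)) (hS : ∀ N ∈ S, IsSemiprimeIn N ∨ N = ⊤) :
    IsSemiprimeIn (sInf S) ∨ sInf S = ⊤ := by
  by_cases h : sInf S = ⊤
  · exact Or.inr h
  · refine Or.inl ⟨h, isFullyInvariant_sInf fun N hN => ?_, fun L hL hLL => ?_⟩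
    · rcases hS N hN with h' | rfl
      · exact h'.2.1
      · exact fun f => by simp
    · refine le_sInf fun N hN => ?_
      rcases hS N hN with h' | rfl
      · exact h'.2.2 L hL (hLL.trans (sInf_le hN))
      · exact le_top

instance : InfSet (SP R M) where
  sInf S := ⟨sInf (Subtype.val '' S), sInf_mem_SP R M _ (by rintro _ ⟨N, _, rfl⟩; exact N.2)⟩

/-- `SP(M)` is a complete lattice in which infima are intersections. -/
instance : CompleteLattice (SP R M) :=
  completeLatticeOfInf (SP R M) fun S =>
    ⟨fun N hN => show sInf (Subtype.val '' S) ≤ N.1 from sInf_le ⟨N, hN, rfl⟩,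
      fun N hN => show N.1 ≤ sInf (Subtype.val '' S) from
        le_sInf (by rintro _ ⟨L, hL, rfl⟩; exact hN hL)⟩

end ModuleProperties

section Frame

/-- The negation `¬ a = ⋁ {x | x ∧ a = 0}` of a frame. -/
def neg {A : Type v} [CompleteLattice A] (a : A) : A :=
  sSup {x | x ⊓ a = ⊥}

theorem neg_eq_compl {A : Type v} [Order.Frame A] (a : A) : neg a = aᶜ := by
  refine le_antisymm (sSup_le fun x hx => ?_) (le_sSup (compl_inf_self a))
  exact le_compl_iff_disjoint_right.2 (disjoint_iff.2 hx)

/-- The De Morgan law `¬(a ∧ b) = ¬a ∨ ¬b` of a frame. -/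
def FrameSatisfiesDML (A : Type v) [CompleteLattice A] : Prop :=
  ∀ a b : A, neg (a ⊓ b) = neg a ⊔ neg b

end Frame

end FIMod

namespace FIMod

universe u v

/-! ### Annihilators as pseudocomplements; nothing here uses projectivity. -/

section Annihilators

variable {R : Type u} [Ring R] {M : Type v} [AddCommGroup M] [Module R M]

/-! In a semiprime module `ann` is the pseudocomplement on fully invariant submodules: `N ⊓ L = ⊥`
iff `N ≤ ann L` (`inf_eq_bot_iff_le_ann`). Conditions 1-4 then all say that `ann N` is complemented
by `ann (ann N)`. Retractability together with `ann N ⊔ ann (ann N) = ⊤` already forces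
semiprimeness, and centrality of the projections amounts to full invariance of the complement.

Projectivity enters only for 5 and 6, where primes must detect both ends of the lattice: a fully
invariant submodule contained in no prime is `⊤` (`exists_isPrimeIn_ge`), and in a semiprime module
a submodule contained in every prime is `⊥` (`exists_isPrimeIn_notMem`). The first adapts the proof
that a nonzero projective module has a maximal submodule, the second the m-sequence argument for
semiprime rings. With these, `⊤` as a join in `SP(M)`, or openness of a closure in `Spec(M)`,
becomes an equality of sums of submodules. -/

theorem prod_le_iff {N K P : Submodule R M} :
    prod N K ≤ P ↔ ∀ (f : M →ₗ[R] K), ∀ x ∈ N, (f x : M) ∈ P := by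
  simp only [prod, iSup_le_iff, Submodule.map_le_iff_le_comap]
  rfl

theorem apply_mem_prod {N K : Submodule R M} (f : M →ₗ[R] K) {x : M} (hx : x ∈ N) :
    (f x : M) ∈ prod N K :=
  prod_le_iff.1 le_rfl f x hx

theorem mem_ann {K : Submodule R M} {x : M} : x ∈ ann K ↔ ∀ f : M →ₗ[R] K, f x = 0 := by
  simp [ann, Submodule.mem_iInf]

theorem prod_le_right (N K : Submodule R M) : prod N K ≤ K :=
  prod_le_iff.2 fun f x _ => (f x).2

theorem prod_le_left {N : Submodule R M} (hN : N.IsFullyInvariant) (K : Submodule R M) :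
    prod N K ≤ N :=
  prod_le_iff.2 fun f _ hx => hN (K.subtype ∘ₗ f) hx

theorem prod_le_inf {N : Submodule R M} (hN : N.IsFullyInvariant) (K : Submodule R M) :
    prod N K ≤ N ⊓ K :=
  le_inf (prod_le_left hN K) (prod_le_right N K)

theorem isFullyInvariant_bot : (⊥ : Submodule R M).IsFullyInvariant := fun _ => bot_le

theorem isFullyInvariant_top : (⊤ : Submodule R M).IsFullyInvariant := fun _ => le_top

theorem isFullyInvariant_sup {N L : Submodule R M} (hN : N.IsFullyInvariant)
    (hL : L.IsFullyInvariant) : (N ⊔ L).IsFullyInvariant :=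
  fun f => sup_le ((hN f).trans (Submodule.comap_mono le_sup_left))
    ((hL f).trans (Submodule.comap_mono le_sup_right))

theorem isFullyInvariant_prod (N : Submodule R M) {K : Submodule R M}
    (hK : K.IsFullyInvariant) : (prod N K).IsFullyInvariant := by
  refine fun φ => prod_le_iff.2 fun f x hx => ?_
  exact apply_mem_prod ((φ.restrict (p := K) (q := K) fun _ h => hK φ h) ∘ₗ f) hx

theorem isFullyInvariant_ann (K : Submodule R M) : (ann K).IsFullyInvariant :=
  fun φ _ hx => mem_ann.2 fun f => mem_ann.1 hx (f ∘ₗ φ)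

theorem prod_eq_bot_iff {N K : Submodule R M} : prod N K = ⊥ ↔ N ≤ ann K := by
  rw [← le_bot_iff, prod_le_iff]
  simp only [Submodule.mem_bot, ZeroMemClass.coe_eq_zero]
  exact ⟨fun h x hx => mem_ann.2 fun f => h f x hx, fun h f x hx => mem_ann.1 (h hx) f⟩

theorem prod_ann (K : Submodule R M) : prod (ann K) K = ⊥ :=
  prod_eq_bot_iff.2 le_rfl

theorem ann_antitone {N K : Submodule R M} (h : N ≤ K) : ann K ≤ ann N :=
  prod_eq_bot_iff.1 <| le_bot_iff.1 <| (prod_mono le_rfl h).trans (prod_ann K).le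

theorem ann_bot : ann (⊥ : Submodule R M) = ⊤ :=
  top_le_iff.1 <| prod_eq_bot_iff.1 <| le_bot_iff.1 <| prod_le_right _ _

theorem isPrimeIn_le_or {P N L : Submodule R M} (hP : IsPrimeIn P) (hN : N.IsFullyInvariant)
    (hL : L.IsFullyInvariant) (h : N ⊓ L = ⊥) : N ≤ P ∨ L ≤ P :=
  hP.2.2 N L hN hL ((prod_le_inf hN L).trans (h.le.trans bot_le))

theorem IsPrimeIn.isSemiprimeIn {P : Submodule R M} (hP : IsPrimeIn P) : IsSemiprimeIn P :=
  ⟨hP.1, hP.2.1, fun L hL h => (hP.2.2 L L hL hL h).elim id id⟩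

namespace IsSemiprimeModule

theorem eq_bot (h : IsSemiprimeModule R M) {N L K : Submodule R M} (hK : K.IsFullyInvariant)
    (hN : K ≤ N) (hL : K ≤ L) (hNL : prod N L = ⊥) : K = ⊥ :=
  le_bot_iff.1 <| h.2.2 K hK <| (prod_mono hN hL).trans hNL.le

theorem inf_eq_bot_iff_le_ann (h : IsSemiprimeModule R M) {N L : Submodule R M}
    (hN : N.IsFullyInvariant) (hL : L.IsFullyInvariant) : N ⊓ L = ⊥ ↔ N ≤ ann L := by
  rw [← prod_eq_bot_iff]
  exact ⟨fun e => le_bot_iff.1 ((prod_le_inf hN L).trans e.le),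
    fun e => h.eq_bot (isFullyInvariant_inf hN hL) inf_le_left inf_le_right e⟩

theorem ann_inf (h : IsSemiprimeModule R M) {N : Submodule R M} (hN : N.IsFullyInvariant) :
    ann N ⊓ N = ⊥ :=
  (h.inf_eq_bot_iff_le_ann (isFullyInvariant_ann N) hN).2 le_rfl

theorem isFIRetractable (h : IsSemiprimeModule R M) : IsFIRetractable R M := by
  intro K hK hne
  by_contra! hf
  refine hne (h.eq_bot hK le_rfl le_rfl (prod_eq_bot_iff.2 fun x _ => mem_ann.2 fun f => ?_))
  rw [hf f, LinearMap.zero_apply]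

/-- The triple intersection, multiplied by itself, lands in both `X` and `prod N L`, so
semiprimeness kills it. -/
theorem inf_inf_eq_bot_of_inf_prod (h : IsSemiprimeModule R M) {X N L : Submodule R M}
    (hX : X.IsFullyInvariant) (hN : N.IsFullyInvariant) (hL : L.IsFullyInvariant)
    (e : X ⊓ prod N L = ⊥) : X ⊓ (N ⊓ L) = ⊥ := by
  have hY := isFullyInvariant_inf hX (isFullyInvariant_inf hN hL)
  refine h.eq_bot hY le_rfl le_rfl (le_bot_iff.1 (le_trans (le_inf ?_ ?_) e.le))
  · exact (prod_le_left hY _).trans inf_le_left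
  · exact prod_mono (inf_le_right.trans inf_le_left) (inf_le_right.trans inf_le_right)

theorem ann_prod (h : IsSemiprimeModule R M) {N L : Submodule R M}
    (hN : N.IsFullyInvariant) (hL : L.IsFullyInvariant) : ann (prod N L) = ann (N ⊓ L) := by
  refine le_antisymm ?_ (ann_antitone (prod_le_inf hN L))
  have hX := isFullyInvariant_ann (prod N L)
  exact (h.inf_eq_bot_iff_le_ann hX (isFullyInvariant_inf hN hL)).1 <|
    h.inf_inf_eq_bot_of_inf_prod hX hN hL (h.ann_inf (isFullyInvariant_prod N hL))

theorem isCompl_ann_ann (h : IsSemiprimeModule R M) {N : Submodule R M}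
    (e : ann N ⊔ ann (ann N) = ⊤) : IsCompl (ann N) (ann (ann N)) := by
  refine ⟨disjoint_iff.2 ?_, codisjoint_iff.2 e⟩
  rw [inf_comm]
  exact h.ann_inf (isFullyInvariant_ann N)

theorem ann_mem_SP (h : IsSemiprimeModule R M) {N : Submodule R M} (hN : N.IsFullyInvariant) :
    IsSemiprimeIn (ann N) ∨ ann N = ⊤ := by
  refine or_iff_not_imp_right.2 fun hne => ⟨hne, isFullyInvariant_ann N, fun L hL hLL => ?_⟩
  rw [← h.inf_eq_bot_iff_le_ann hL hN, inf_comm]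
  rw [← h.inf_eq_bot_iff_le_ann (isFullyInvariant_prod L hL) hN, inf_comm] at hLL
  simpa using h.inf_inf_eq_bot_of_inf_prod hN hL hL hLL

end IsSemiprimeModule

/-- If `prod K K = ⊥` then `K ≤ ann K`, hence `ann (ann K) ≤ ann K` and `ann K = ⊤`. No nonzero map
reaches `K`, so `K = ⊥` by retractability. -/
theorem IsFIRetractable.isSemiprimeModule [Nontrivial M] (hr : IsFIRetractable R M)
    (h : ∀ N : Submodule R M, N.IsFullyInvariant → ann N ⊔ ann (ann N) = ⊤) :
    IsSemiprimeModule R M := by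
  refine ⟨bot_ne_top, isFullyInvariant_bot, fun K hK e => ?_⟩
  by_contra hne
  obtain ⟨f, hf⟩ := hr K hK fun e => hne e.le
  refine hf (LinearMap.ext fun x => mem_ann.1 ?_ f)
  have h2 : ann (ann K) ≤ ann K := ann_antitone (prod_eq_bot_iff.1 (le_bot_iff.1 e))
  have h3 : ann K = ⊤ := by rw [← h K hK, sup_eq_left.2 h2]
  rw [h3]
  trivial

theorem le_sup_inf_of_isCompl {A B X : Submodule R M} (h : IsCompl A B)
    (hX : X.IsFullyInvariant) :
    X ≤ X ⊓ A ⊔ X ⊓ B := by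
  intro x hx
  rw [← Submodule.projection_add_projection_eq_self h x]
  refine Submodule.add_mem_sup ⟨hX _ hx, ?_⟩ ⟨hX _ hx, ?_⟩ <;> exact Submodule.projection_apply_mem _ _

/-- A fully invariant `X` splits along `ann L ⊕ ann (ann L)`. For `X = ann (N ⊓ L)` the second piece
meets `N` trivially, hence lies in `ann N`. -/
theorem IsSemiprimeModule.satisfiesDML (hs : IsSemiprimeModule R M)
    (h : ∀ N : Submodule R M, N.IsFullyInvariant → IsCompl (ann N) (ann (ann N))) :
    SatisfiesDML R M := by
  intro N L hN hL
  refine le_antisymm ?_ (sup_le (ann_antitone inf_le_left) (ann_antitone inf_le_right))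
  set X := ann (N ⊓ L)
  have hX : X.IsFullyInvariant := isFullyInvariant_ann _
  have hB := isFullyInvariant_ann L
  have hBB := isFullyInvariant_ann (ann L)
  have h1 : (X ⊓ N) ⊓ L = ⊥ := by
    rw [inf_assoc]
    exact hs.ann_inf (isFullyInvariant_inf hN hL)
  have h2 : X ⊓ N ≤ ann L := (hs.inf_eq_bot_iff_le_ann (isFullyInvariant_inf hX hN) hL).1 h1
  have h3 : (X ⊓ ann (ann L)) ⊓ N = ⊥ := by
    rw [← le_bot_iff, ← hs.ann_inf hB]
    exact le_inf (inf_le_left.trans inf_le_right)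
      ((le_inf (inf_le_left.trans inf_le_left) inf_le_right).trans h2)
  have h4 : X ⊓ ann (ann L) ≤ ann N :=
    (hs.inf_eq_bot_iff_le_ann (isFullyInvariant_inf hX hBB) hN).1 h3
  refine (le_sup_inf_of_isCompl (h L hL) hX).trans (sup_le ?_ ?_)
  · exact inf_le_right.trans le_sup_right
  · exact h4.trans le_sup_left

theorem projection_mem_center {A B L : Submodule R M} (hA : A.IsFullyInvariant)
    (hB : B.IsFullyInvariant) (hAB : IsCompl A B) (hAL : IsCompl A L) :
    (A.projection L hAL : Module.End R M) ∈ Set.center (Module.End R M) := by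
  have comm : ∀ f : Module.End R M, A.projection B hAB * f = f * A.projection B hAB := by
    intro f
    ext x
    have hx := Submodule.projection_add_projection_eq_self hAB x
    have h1 : f (A.projection B hAB x) ∈ A := hA f (Submodule.projection_apply_mem _ _)
    have h2 : f (B.projection A hAB.symm x) ∈ B := hB f (Submodule.projection_apply_mem _ _)
    calc A.projection B hAB (f x)
        = A.projection B hAB (f (A.projection B hAB x) + f (B.projection A hAB.symm x)) := by
          rw [← map_add, hx]
      _ = f (A.projection B hAB x) := by
          rw [map_add, Submodule.projection_apply_of_mem_left hAB h1,
            Submodule.projection_apply_of_mem_right hAB h2, add_zero]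
  -- Two commuting projections with the same image `A` are equal, so the choice of `L` does not
  -- matter.
  have e : A.projection L hAL = A.projection B hAB := by
    have h1 := comm (A.projection L hAL)
    ext x
    have := LinearMap.congr_fun h1 x
    simp only [Module.End.mul_apply] at this
    rwa [Submodule.projection_apply_of_mem_left hAB (Submodule.projection_apply_mem hAL x),
      Submodule.projection_apply_of_mem_left hAL (Submodule.projection_apply_mem hAB x)] at this
  rw [e, Semigroup.mem_center_iff]
  exact fun f => (comm f).symm

theorem isFullyInvariant_of_projection_mem_center {A L : Submodule R M} (h : IsCompl A L)
    (hc : (A.projection L h : Module.End R M) ∈ Set.center (Module.End R M)) :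
    L.IsFullyInvariant := by
  intro f x hx
  rw [Semigroup.mem_center_iff] at hc
  have := LinearMap.congr_fun (hc f) x
  simp only [Module.End.mul_apply] at this
  rw [Submodule.projection_apply_of_mem_right h hx, map_zero] at this
  exact (Submodule.projection_apply_eq_zero_iff h).1 this.symm

end Annihilators

/-! ### Projectivity in `σ[M]`: additivity of the product and primes above a proper submodule. -/

section Projectivity

variable {R : Type u} [Ring R] {M : Type v} [AddCommGroup M] [Module R M]

theorem IsGenerated.isSubgenerated {A B : Type v} [AddCommGroup A] [Module R A]
    [AddCommGroup B] [Module R B] (h : IsGenerated R M B) (i : A →ₗ[R] B)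
    (hi : Function.Injective i) : IsSubgenerated R M A :=
  ⟨B, _, _, h, i, hi⟩

theorem isGenerated_finsupp_quotient (X : Type v) (N : Submodule R M) :
    IsGenerated R M (X →₀ M ⧸ N) :=
  ⟨X, Finsupp.mapRange.linearMap N.mkQ,
    Finsupp.mapRange_surjective _ (map_zero _) N.mkQ_surjective⟩

theorem isGenerated_prod_self : IsGenerated R M (M × M) := by
  refine ⟨ULift Bool, (Finsupp.lapply ⟨true⟩).prod (Finsupp.lapply ⟨false⟩), ?_⟩
  rintro ⟨a, b⟩
  refine ⟨Finsupp.single ⟨true⟩ a + Finsupp.single ⟨false⟩ b, ?_⟩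
  simp

theorem isGenerated_self : IsGenerated R M M :=
  ⟨PUnit, Finsupp.lapply PUnit.unit, fun a => ⟨Finsupp.single PUnit.unit a, by simp⟩⟩

theorem isSubgenerated_submodule (K : Submodule R M) : IsSubgenerated R M K :=
  isGenerated_self.isSubgenerated K.subtype K.injective_subtype

theorem isSubgenerated_prod_submodule (K L : Submodule R M) : IsSubgenerated R M (K × L) :=
  isGenerated_prod_self.isSubgenerated (K.subtype.prodMap L.subtype)
    (Function.Injective.prodMap K.injective_subtype L.injective_subtype)

theorem IsProjectiveInSigma.prod_sup_le (hM : IsProjectiveInSigma R M)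
    (N K L : Submodule R M) : prod N (K ⊔ L) ≤ prod N K ⊔ prod N L := by
  refine prod_le_iff.2 fun f x hx => ?_
  let g : K × L →ₗ[R] ↥(K ⊔ L) :=
    (Submodule.inclusion le_sup_left).coprod (Submodule.inclusion le_sup_right)
  have hg : Function.Surjective g := by
    rintro ⟨y, hy⟩
    obtain ⟨a, ha, b, hb, rfl⟩ := Submodule.mem_sup.1 hy
    exact ⟨(⟨a, ha⟩, ⟨b, hb⟩), by ext; simp [g]⟩
  obtain ⟨h, rfl⟩ := hM _ _ (isSubgenerated_prod_submodule K L) g f hg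
  have e : ((g ∘ₗ h) x : M) = (LinearMap.fst R K L ∘ₗ h) x + (LinearMap.snd R K L ∘ₗ h) x := by
    simp [g]
  rw [e]
  exact Submodule.add_mem_sup (apply_mem_prod _ hx) (apply_mem_prod _ hx)

theorem prod_sup_left_le (N N' K : Submodule R M) :
    prod (N ⊔ N') K ≤ prod N K ⊔ prod N' K := by
  refine prod_le_iff.2 fun f x hx => ?_
  obtain ⟨a, ha, b, hb, rfl⟩ := Submodule.mem_sup.1 hx
  rw [map_add]
  exact Submodule.add_mem_sup (apply_mem_prod f ha) (apply_mem_prod f hb)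

/-- `φ` lifts to an endomorphism of `M`, which maps `N` into itself and so into `K`. -/
theorem IsProjectiveInSigma.le_ker_of_isFullyInvariant (hM : IsProjectiveInSigma R M)
    {N K : Submodule R M} (hN : N.IsFullyInvariant) (hNK : N ≤ K) (φ : M →ₗ[R] M ⧸ K) :
    N ≤ LinearMap.ker φ := by
  obtain ⟨g, rfl⟩ := hM _ _ (isGenerated_self.isSubgenerated LinearMap.id fun _ _ h => h)
    K.mkQ φ K.mkQ_surjective
  intro x hx
  simpa using hNK (hN g hx)

theorem exists_isCoatom_of_fg_sup {P : Type*} [AddCommGroup P] [Module R P]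
    {K L : Submodule R P} (hK : K.FG) (h : K ⊔ L = ⊤) (hL : L ≠ ⊤) :
    ∃ C : Submodule R P, IsCoatom C := by
  have : Module.Finite R K := Module.Finite.iff_fg.2 hK
  have hs : Function.Surjective (L.mkQ ∘ₗ K.subtype) := by
    rw [← LinearMap.range_eq_top, LinearMap.range_comp, Submodule.range_subtype,
      Submodule.map_mkQ_eq_top, sup_comm, h]
  have : Module.Finite R (P ⧸ L) := Module.Finite.of_surjective _ hs
  have : Nontrivial (P ⧸ L) := Submodule.Quotient.nontrivial_iff.2 hL
  obtain ⟨C, hC, -⟩ :=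
    (eq_top_or_exists_le_coatom (⊥ : Submodule R (P ⧸ L))).resolve_left bot_ne_top
  exact ⟨_, (Submodule.isCoatom_comap_iff L.mkQ_surjective).2 hC⟩

/-- A dual basis for the quotient of `M` by a fully invariant submodule. -/
theorem IsProjectiveInSigma.exists_dual_family (hM : IsProjectiveInSigma R M)
    {N : Submodule R M} (hN : N.IsFullyInvariant) :
    ∃ h : M ⧸ N →ₗ[R] (M ⧸ N →₀ M ⧸ N),
      (∀ q x, h q x ∈ Submodule.span R {x}) ∧ ∀ q, ((h q).sum fun _ y => y) = q := by
  -- `S` is the direct sum of the cyclic submodules `R x`. A lift of `N.mkQ` through its sum map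
  -- kills `N` coordinatewise, so it descends to `M ⧸ N`.
  let S : Submodule R (M ⧸ N →₀ M ⧸ N) :=
    ⨅ x, (Submodule.span R {x}).comap (Finsupp.lapply x)
  let s : S →ₗ[R] M ⧸ N := Finsupp.lsum ℕ (fun _ => LinearMap.id) ∘ₗ S.subtype
  have hs : Function.Surjective s := by
    intro x
    refine ⟨⟨Finsupp.single x x, ?_⟩, by simp [s]⟩
    refine (Submodule.mem_iInf _).2 fun y => ?_
    rw [Submodule.mem_comap, Finsupp.lapply_apply]
    by_cases e : x = y <;> simp [e]
  obtain ⟨g, hg⟩ := hM S (M ⧸ N) ((isGenerated_finsupp_quotient (M ⧸ N) N).isSubgenerated S.subtype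
    S.injective_subtype) s N.mkQ hs
  have hk : N ≤ LinearMap.ker (S.subtype ∘ₗ g) := by
    intro x hx
    ext y
    exact hM.le_ker_of_isFullyInvariant hN le_rfl (Finsupp.lapply y ∘ₗ S.subtype ∘ₗ g) hx
  refine ⟨N.liftQ _ hk, fun q x => ?_, fun q => ?_⟩
  · obtain ⟨m, rfl⟩ := N.mkQ_surjective q
    exact (Submodule.mem_iInf _).1 (g m).2 x
  · obtain ⟨m, rfl⟩ := N.mkQ_surjective q
    exact LinearMap.congr_fun hg m

/-- Without maximal submodules every finitely generated submodule is superfluous. The dual family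
yields `f` with finitely generated image bound and `f q = q ≠ 0`. Then `1 - f` is surjective with a
right inverse `t`, itself surjective; writing `q = t y` gives `y = q - f q = 0`, a contradiction. -/
theorem IsProjectiveInSigma.exists_isCoatom_quotient (hM : IsProjectiveInSigma R M)
    {N : Submodule R M} (hN : N.IsFullyInvariant) (hN' : N ≠ ⊤) :
    ∃ C : Submodule R (M ⧸ N), IsCoatom C := by
  by_contra hno
  have small : ∀ K L : Submodule R (M ⧸ N), K.FG → K ⊔ L = ⊤ → L = ⊤ := fun K L hK h => by
    by_contra hL
    exact hno (exists_isCoatom_of_fg_sup hK h hL)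
  obtain ⟨h, hspan, hsum⟩ := hM.exists_dual_family hN
  have : Nontrivial (M ⧸ N) := Submodule.Quotient.nontrivial_iff.2 hN'
  obtain ⟨q, hq⟩ := exists_ne (0 : M ⧸ N)
  let f : M ⧸ N →ₗ[R] M ⧸ N := ∑ x ∈ (h q).support, Finsupp.lapply x ∘ₗ h
  have hfq : f q = q := by
    conv_rhs => rw [← hsum q]
    simp [f, Finsupp.sum, LinearMap.sum_apply]
  let K : Submodule R (M ⧸ N) := Submodule.span R ((h q).support : Set (M ⧸ N))
  have hK : K.FG := ⟨_, rfl⟩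
  have hfK : ∀ y, f y ∈ K := by
    intro y
    simp only [f, LinearMap.sum_apply]
    exact Submodule.sum_mem _ fun x hx =>
      Submodule.span_mono (Set.singleton_subset_iff.2 hx) (hspan y x)
  have hd : Function.Surjective (LinearMap.id - f : M ⧸ N →ₗ[R] M ⧸ N) := by
    rw [← LinearMap.range_eq_top]
    refine small K _ hK (top_le_iff.1 fun y _ => ?_)
    rw [show y = f y + (LinearMap.id - f : M ⧸ N →ₗ[R] M ⧸ N) y by simp]
    exact Submodule.add_mem_sup (hfK y) (LinearMap.mem_range_self _ _)
  have hsub : IsSubgenerated R M (M ⧸ N) :=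
    IsGenerated.isSubgenerated ⟨PUnit, N.mkQ ∘ₗ Finsupp.lapply PUnit.unit,
      N.mkQ_surjective.comp fun a => ⟨Finsupp.single PUnit.unit a, by simp⟩⟩
      LinearMap.id fun _ _ h => h
  obtain ⟨g, hg⟩ := hM _ _ hsub _ N.mkQ hd
  have hgk := hM.le_ker_of_isFullyInvariant hN le_rfl g
  let t : M ⧸ N →ₗ[R] M ⧸ N := N.liftQ g hgk
  have ht : ∀ y, t y - f (t y) = y := by
    intro y
    obtain ⟨m, rfl⟩ := N.mkQ_surjective y
    exact LinearMap.congr_fun hg m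
  have htop : LinearMap.range t = ⊤ := by
    refine small K _ hK (top_le_iff.1 fun y _ => ?_)
    have e : y = f (y - t (y - f y)) + t (y - f y) := by
      calc y = f y + (y - f y) := by abel
        _ = f y + (t (y - f y) - f (t (y - f y))) := by rw [ht]
        _ = f (y - t (y - f y)) + t (y - f y) := by rw [map_sub f y]; abel
    rw [e]
    exact Submodule.add_mem_sup (hfK _) (LinearMap.mem_range_self _ _)
  obtain ⟨y, rfl⟩ := LinearMap.range_eq_top.1 htop q
  have hy := ht y
  rw [hfq, sub_self] at hy
  rw [← hy, map_zero] at hq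
  exact hq rfl

theorem IsProjectiveInSigma.exists_isPrimeIn_ge (hM : IsProjectiveInSigma R M)
    {N : Submodule R M} (hN : N.IsFullyInvariant) (hN' : N ≠ ⊤) :
    ∃ P : Submodule R M, IsPrimeIn P ∧ N ≤ P := by
  obtain ⟨C, hC⟩ := hM.exists_isCoatom_quotient hN hN'
  set K := C.comap N.mkQ
  have hK : IsCoatom K := (Submodule.isCoatom_comap_iff N.mkQ_surjective).2 hC
  have hNK : N ≤ K := fun x hx => by simp [K, (Submodule.Quotient.mk_eq_zero N).2 hx]
  -- `P` is the largest fully invariant submodule inside the maximal submodule `K`, the analogue of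
  -- a primitive ideal.
  let P : Submodule R M := ⨅ f : M →ₗ[R] M ⧸ K, LinearMap.ker f
  have hPK : P ≤ K := (iInf_le _ K.mkQ).trans K.ker_mkQ.le
  have hle : ∀ L : Submodule R M, L.IsFullyInvariant → L ≤ K → L ≤ P := fun L hL h =>
    le_iInf fun f => hM.le_ker_of_isFullyInvariant hL h f
  refine ⟨P, ⟨?_, ?_, fun L L' hL hL' h => ?_⟩, hle N hN hNK⟩
  · rintro e
    exact hK.1 (top_le_iff.1 (e ▸ hPK))
  · intro φ x hx
    exact (Submodule.mem_iInf _).2 fun f => (Submodule.mem_iInf _).1 hx (f ∘ₗ φ)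
  · refine or_iff_not_imp_right.2 fun hn => le_iInf fun f => ?_
    -- Since `L'` maps onto `M ⧸ K`, every `f` lifts to some `g : M → L'`, and `g` sends `L` into
    -- `prod L L' ≤ P ≤ K`.
    have hsup : K ⊔ L' = ⊤ := hK.2 _ (left_lt_sup.2 fun h' => hn (hle L' hL' h'))
    have hs : Function.Surjective (K.mkQ ∘ₗ L'.subtype) := by
      rw [← LinearMap.range_eq_top, LinearMap.range_comp, Submodule.range_subtype,
        Submodule.map_mkQ_eq_top, hsup]
    obtain ⟨g, rfl⟩ := hM _ _ (isSubgenerated_submodule L') _ f hs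
    intro x hx
    simpa using hPK (h (apply_mem_prod g hx))

/-! ### Enough primes in a semiprime module. -/

/-- The least fully invariant submodule containing `x`. -/
def fiSpan (R : Type u) {M : Type v} [Ring R] [AddCommGroup M] [Module R M] (x : M) :
    Submodule R M :=
  sInf {N | N.IsFullyInvariant ∧ x ∈ N}

theorem isFullyInvariant_fiSpan (x : M) : (fiSpan R x).IsFullyInvariant :=
  isFullyInvariant_sInf fun _ h => h.1

theorem mem_fiSpan (x : M) : x ∈ fiSpan R x :=
  (Submodule.mem_sInf).2 fun _ h => h.2

theorem fiSpan_le {x : M} {N : Submodule R M} (hN : N.IsFullyInvariant) (hx : x ∈ N) :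
    fiSpan R x ≤ N :=
  sInf_le ⟨hN, hx⟩

/-- A module analogue of an `m`-sequence of nonzero elements. -/
theorem IsSemiprimeModule.exists_mSequence (hs : IsSemiprimeModule R M) {x : M} (hx : x ≠ 0) :
    ∃ s : ℕ → M, s 0 = x ∧ (∀ n, s n ≠ 0) ∧
      ∀ n, s (n + 1) ∈ prod (fiSpan R (s n)) (fiSpan R (s n)) := by
  have step : ∀ y : {y : M // y ≠ 0}, ∃ z : {z : M // z ≠ 0},
      z.1 ∈ prod (fiSpan R y.1) (fiSpan R y.1) := by
    rintro ⟨y, hy⟩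
    have hne : prod (fiSpan R y) (fiSpan R y) ≠ ⊥ := fun e => hy <| by
      simpa using hs.2.2 _ (isFullyInvariant_fiSpan y) e.le (mem_fiSpan y)
    obtain ⟨z, hz, hz0⟩ := Submodule.exists_mem_ne_zero_of_ne_bot hne
    exact ⟨⟨z, hz0⟩, hz⟩
  choose F hF using step
  let s : ℕ → {y : M // y ≠ 0} := fun n => F^[n] ⟨x, hx⟩
  refine ⟨fun n => (s n).1, rfl, fun n => (s n).2, fun n => ?_⟩
  have : s (n + 1) = F (s n) := Function.iterate_succ_apply' _ _ _
  simp only [this]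
  exact hF _

theorem IsProjectiveInSigma.exists_isPrimeIn_notMem (hM : IsProjectiveInSigma R M)
    (hs : IsSemiprimeModule R M) {x : M} (hx : x ≠ 0) :
    ∃ P : Submodule R M, IsPrimeIn P ∧ x ∉ P := by
  obtain ⟨s, rfl, hs0, hss⟩ := hs.exists_mSequence hx
  have hanti : Antitone fun n => fiSpan R (s n) := antitone_nat_of_succ_le fun n =>
    fiSpan_le (isFullyInvariant_fiSpan _) (prod_le_right _ _ (hss n))
  -- A fully invariant submodule maximal among those avoiding the whole sequence is prime.
  obtain ⟨P, -, hP⟩ := zorn_le_nonempty₀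
    {P : Submodule R M | P.IsFullyInvariant ∧ ∀ n, s n ∉ P} (fun c hc hchain y hy => by
      refine ⟨sSup c, ⟨isFullyInvariant_sSup fun N hN => (hc hN).1, fun n hn => ?_⟩,
        fun z hz => le_sSup hz⟩
      obtain ⟨N, hN, hn'⟩ :=
        (Submodule.mem_sSup_of_directed ⟨y, hy⟩ hchain.directedOn).1 hn
      exact (hc hN).2 n hn') ⊥ ⟨isFullyInvariant_bot, fun n => by simpa using hs0 n⟩
  have key : ∀ L : Submodule R M, L.IsFullyInvariant → ¬ L ≤ P → ∃ n, fiSpan R (s n) ≤ P ⊔ L := by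
    intro L hL hLP
    have hFI := isFullyInvariant_sup hP.prop.1 hL
    by_contra! hno
    exact hLP (le_sup_right.trans (hP.le_of_ge
      ⟨hFI, fun n hn => hno n (fiSpan_le hFI hn)⟩ le_sup_left))
  refine ⟨P, ⟨?_, hP.prop.1, fun L K hL hK h => ?_⟩, hP.prop.2 0⟩
  · rintro rfl
    exact hP.prop.2 0 trivial
  · by_contra! hn
    obtain ⟨i, hi⟩ := key L hL hn.1
    obtain ⟨j, hj⟩ := key K hK hn.2
    -- The spans decrease, so the span of term `max i j` lies in both `P ⊔ L` and `P ⊔ K`; the next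
    -- term lies in their product, hence in `P`.
    refine hP.prop.2 (max i j + 1) ?_
    have h1 : prod (P ⊔ L) (P ⊔ K) ≤ P := by
      refine (prod_sup_left_le _ _ _).trans (sup_le (prod_le_left hP.prop.1 _) ?_)
      exact (hM.prod_sup_le _ _ _).trans (sup_le (prod_le_right _ _) h)
    exact h1 (prod_mono ((hanti (le_max_left i j)).trans hi)
      ((hanti (le_max_right i j)).trans hj) (hss _))

theorem IsProjectiveInSigma.eq_bot_of_le_isPrimeIn (hM : IsProjectiveInSigma R M)
    (hs : IsSemiprimeModule R M) {N : Submodule R M} (h : ∀ P, IsPrimeIn P → N ≤ P) :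
    N = ⊥ := by
  by_contra hne
  obtain ⟨x, hx, hx0⟩ := Submodule.exists_mem_ne_zero_of_ne_bot hne
  obtain ⟨P, hP, hxP⟩ := hM.exists_isPrimeIn_notMem hs hx0
  exact hxP (h P hP hx)

theorem IsProjectiveInSigma.eq_top_of_not_le_isPrimeIn (hM : IsProjectiveInSigma R M)
    {N : Submodule R M} (hN : N.IsFullyInvariant) (h : ∀ P, IsPrimeIn P → ¬ N ≤ P) :
    N = ⊤ := by
  by_contra hne
  obtain ⟨P, hP, hNP⟩ := hM.exists_isPrimeIn_ge hN hne
  exact h P hP hNP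

end Projectivity

/-! ### The frame `SP(M)` and the topology of `Spec(M)`. -/

section FrameAndSpectrum

variable {R : Type u} [Ring R] {M : Type v} [AddCommGroup M] [Module R M]

theorem SP.isFullyInvariant (a : SP R M) : a.1.IsFullyInvariant :=
  a.2.elim (fun h => h.2.1) fun h => by rw [h]; exact isFullyInvariant_top

/-- A semiprime submodule, or the greatest submodule, as an element of `SP(M)`. -/
def SP.of (N : Submodule R M) (h : IsSemiprimeIn N ∨ N = ⊤) : SP R M :=
  ⟨N, h⟩

theorem SP.le_iff {a b : SP R M} : a ≤ b ↔ a.1 ≤ b.1 :=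
  Iff.rfl

theorem SP.val_inf (a b : SP R M) : (a ⊓ b).1 = a.1 ⊓ b.1 := by
  have h : IsSemiprimeIn (a.1 ⊓ b.1) ∨ a.1 ⊓ b.1 = ⊤ := by
    rw [← sInf_pair]
    exact sInf_mem_SP R M _ (by rintro N (rfl | rfl); exacts [a.2, b.2])
  refine le_antisymm (le_inf (SP.le_iff.1 inf_le_left) (SP.le_iff.1 inf_le_right)) ?_
  exact SP.le_iff.1 (le_inf ((SP.le_iff (a := SP.of _ h) (b := a)).2 inf_le_left)
    ((SP.le_iff (b := b)).2 inf_le_right))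

theorem SP.val_bot (hs : IsSemiprimeModule R M) : (⊥ : SP R M).1 = ⊥ :=
  le_bot_iff.1 (SP.le_iff.1 (bot_le (a := SP.of ⊥ (Or.inl hs))))

theorem SP.inf_eq_bot_iff (hs : IsSemiprimeModule R M) (a b : SP R M) :
    a ⊓ b = ⊥ ↔ a.1 ⊓ b.1 = ⊥ := by
  rw [← SP.val_inf, ← SP.val_bot hs]
  exact Subtype.ext_iff

theorem SP.neg_eq (hs : IsSemiprimeModule R M) (a : SP R M) :
    neg a = SP.of (ann a.1) (hs.ann_mem_SP a.isFullyInvariant) := by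
  refine le_antisymm (sSup_le fun x hx => ?_) (le_sSup ?_)
  · exact (hs.inf_eq_bot_iff_le_ann x.isFullyInvariant a.isFullyInvariant).1
      ((SP.inf_eq_bot_iff hs x a).1 hx)
  · exact (SP.inf_eq_bot_iff hs _ a).2 (hs.ann_inf a.isFullyInvariant)

theorem IsSemiprimeModule.frameSatisfiesDML (hs : IsSemiprimeModule R M)
    (h : SatisfiesDML R M) : FrameSatisfiesDML (SP R M) := by
  intro a b
  have e : ann (a ⊓ b).1 = ann a.1 ⊔ ann b.1 := by
    rw [SP.val_inf, h _ _ a.isFullyInvariant b.isFullyInvariant]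
  rw [SP.neg_eq hs, SP.neg_eq hs, SP.neg_eq hs]
  refine le_antisymm (SP.le_iff.2 (e.le.trans (sup_le ?_ ?_))) (sup_le ?_ ?_)
  · exact SP.le_iff.1 (le_sup_left (a := SP.of (ann a.1) _))
  · exact SP.le_iff.1 (le_sup_right (b := SP.of (ann b.1) _))
  · exact SP.le_iff.2 (le_sup_left.trans e.ge)
  · exact SP.le_iff.2 (le_sup_right.trans e.ge)

theorem IsProjectiveInSigma.ann_sup_ann_ann_of_frameSatisfiesDML
    (hM : IsProjectiveInSigma R M) (hs : IsSemiprimeModule R M)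
    (h : FrameSatisfiesDML (SP R M)) {N : Submodule R M} (hN : N.IsFullyInvariant) :
    ann N ⊔ ann (ann N) = ⊤ := by
  have hA := isFullyInvariant_ann N
  have hB := isFullyInvariant_ann (ann N)
  let a : SP R M := SP.of (ann N) (hs.ann_mem_SP hN)
  let b : SP R M := SP.of (ann (ann N)) (hs.ann_mem_SP hA)
  have hab : a ⊓ b = ⊥ := by
    rw [SP.inf_eq_bot_iff hs, inf_comm]
    exact hs.ann_inf hA
  have hneg : neg (⊥ : SP R M) = ⊤ := top_le_iff.1 (le_sSup (inf_bot_eq ⊤))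
  have hsup := h a b
  rw [hab, hneg, SP.neg_eq hs, SP.neg_eq hs] at hsup
  -- The join in `SP(M)` may exceed the sum of submodules, but a prime containing the sum belongs to
  -- `SP(M)` and so contains the join, which is `⊤`.
  refine hM.eq_top_of_not_le_isPrimeIn (isFullyInvariant_sup hA hB) fun P hP hle => hP.1 ?_
  let p : SP R M := SP.of P (Or.inl hP.isSemiprimeIn)
  have hNN : ann (ann (ann N)) ≤ ann N := by
    rw [← hs.inf_eq_bot_iff_le_ann (isFullyInvariant_ann _) hN]
    exact hs.eq_bot (isFullyInvariant_inf (isFullyInvariant_ann _) hN) inf_le_left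
      (inf_le_right.trans ((hs.inf_eq_bot_iff_le_ann hN hA).1 (by rw [inf_comm, hs.ann_inf hN])))
      (prod_ann _)
  have hp : (⊤ : SP R M) ≤ p := by
    rw [hsup]
    exact sup_le (SP.le_iff.2 (show ann (ann N) ≤ P from le_sup_right.trans hle))
      (SP.le_iff.2 (show ann (ann (ann N)) ≤ P from hNN.trans (le_sup_left.trans hle)))
  exact top_le_iff.1 (SP.le_iff.1 ((le_top (a := SP.of ⊤ (Or.inr rfl))).trans hp))

theorem isOpen_Spec_iff {U : Set (Spec R M)} :
    IsOpen U ↔ ∃ N : Submodule R M, N.IsFullyInvariant ∧ U = {P : Spec R M | ¬ N ≤ P.1} :=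
  Iff.rfl

theorem isClosed_setOf_le {N : Submodule R M} (hN : N.IsFullyInvariant) :
    IsClosed {P : Spec R M | N ≤ P.1} :=
  ⟨isOpen_Spec_iff.2 ⟨N, hN, rfl⟩⟩

/-- The complement of the closure is the open set of some `L`; it misses that of `N`, so `L ⊓ N`
lies in every prime and vanishes, whence `L ≤ ann N`. -/
theorem IsProjectiveInSigma.closure_setOf_not_le (hM : IsProjectiveInSigma R M)
    (hs : IsSemiprimeModule R M) {N : Submodule R M} (hN : N.IsFullyInvariant) :
    closure {P : Spec R M | ¬ N ≤ P.1} = {P : Spec R M | ann N ≤ P.1} := by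
  refine subset_antisymm (closure_minimal (fun P hP => ?_)
    (isClosed_setOf_le (isFullyInvariant_ann N))) fun P hP => ?_
  · exact (isPrimeIn_le_or P.2 (isFullyInvariant_ann N) hN (hs.ann_inf hN)).resolve_right hP
  · obtain ⟨L, hL, e⟩ := isOpen_Spec_iff.1
      (isClosed_closure (s := {P : Spec R M | ¬ N ≤ P.1})).isOpen_compl
    have hLN : L ⊓ N = ⊥ := hM.eq_bot_of_le_isPrimeIn hs fun Q hQ => by
      by_cases hNQ : N ≤ Q
      · exact inf_le_right.trans hNQ
      · let q : Spec R M := ⟨Q, hQ⟩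
        have hmem : q ∈ closure {P : Spec R M | ¬ N ≤ P.1} := subset_closure hNQ
        rw [← Set.notMem_compl_iff, e] at hmem
        exact inf_le_left.trans (not_not.1 hmem)
    rw [← Set.notMem_compl_iff, e]
    exact not_not.2 (((hs.inf_eq_bot_iff_le_ann hL hN).1 hLN).trans hP)

theorem IsProjectiveInSigma.extremallyDisconnected (hM : IsProjectiveInSigma R M)
    (hs : IsSemiprimeModule R M)
    (h : ∀ N : Submodule R M, N.IsFullyInvariant → IsCompl (ann N) (ann (ann N))) :
    ExtremallyDisconnected (Spec R M) := by
  refine ⟨fun U hU => ?_⟩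
  obtain ⟨N, hN, rfl⟩ := isOpen_Spec_iff.1 hU
  have hA := isFullyInvariant_ann N
  have hB := isFullyInvariant_ann (ann N)
  rw [hM.closure_setOf_not_le hs hN]
  refine isOpen_Spec_iff.2 ⟨ann (ann N), hB, Set.ext fun P => ⟨fun hP hP' => ?_, fun hP => ?_⟩⟩
  · exact P.2.1 (top_le_iff.1 ((h N hN).sup_eq_top.ge.trans (sup_le hP hP')))
  · exact (isPrimeIn_le_or P.2 hA hB (h N hN).inf_eq_bot).resolve_right hP

theorem IsProjectiveInSigma.ann_sup_ann_ann_of_extremallyDisconnected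
    (hM : IsProjectiveInSigma R M) (hs : IsSemiprimeModule R M)
    (h : ExtremallyDisconnected (Spec R M)) {N : Submodule R M} (hN : N.IsFullyInvariant) :
    ann N ⊔ ann (ann N) = ⊤ := by
  have hA := isFullyInvariant_ann N
  have ho := h.open_closure _ (isOpen_Spec_iff.2 ⟨N, hN, rfl⟩)
  rw [hM.closure_setOf_not_le hs hN] at ho
  obtain ⟨L, hL, e⟩ := isOpen_Spec_iff.1 ho
  have key : ∀ P, IsPrimeIn P → (ann N ≤ P ↔ ¬ L ≤ P) := fun P hP =>
    Set.ext_iff.1 e ⟨P, hP⟩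
  -- Each prime contains exactly one of `L` and `ann N`, so their intersection is `⊥` and their sum
  -- is `⊤`.
  have hLA : L ⊓ ann N = ⊥ := hM.eq_bot_of_le_isPrimeIn hs fun P hP => by
    by_cases hLP : L ≤ P
    · exact inf_le_left.trans hLP
    · exact inf_le_right.trans ((key P hP).2 hLP)
  have hle : L ≤ ann (ann N) := (hs.inf_eq_bot_iff_le_ann hL hA).1 hLA
  refine top_le_iff.1 (le_trans (Eq.ge ?_) (sup_le_sup_left hle _))
  exact hM.eq_top_of_not_le_isPrimeIn (isFullyInvariant_sup hA hL) fun P hP hP' =>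
    (key P hP).1 (le_sup_left.trans hP') (le_sup_right.trans hP')

end FrameAndSpectrum

end FIMod

/-! ### The cycle 1-2-3-4, with 5 and 6 attached through 3. -/

theorem mainTheorem2 {R : Type*} [Ring R] {M : Type*} [AddCommGroup M] [Module R M]
    [Nontrivial M] (hM : FIMod.IsProjectiveInSigma R M) :
    List.TFAE [
      FIMod.IsSemiprimeModule R M ∧ FIMod.SatisfiesDML R M,
      FIMod.IsFIRetractable R M ∧
        ∀ N L : Submodule R M, N.IsFullyInvariant → L.IsFullyInvariant →
          FIMod.ann (FIMod.prod N L) = FIMod.ann N ⊔ FIMod.ann L,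
      FIMod.IsFIRetractable R M ∧
        ∀ N : Submodule R M, N.IsFullyInvariant →
          IsCompl (FIMod.ann N) (FIMod.ann (FIMod.ann N)),
      FIMod.IsFIRetractable R M ∧ FIMod.IsFIBaer R M ∧
        ∀ N : Submodule R M, N.IsFullyInvariant →
          ∀ (L : Submodule R M) (h : IsCompl (FIMod.ann N) L),
            IsIdempotentElem ((FIMod.ann N).projection L h : Module.End R M) ∧
              ((FIMod.ann N).projection L h : Module.End R M) ∈ Set.center (Module.End R M),
      FIMod.IsSemiprimeModule R M ∧ FIMod.FrameSatisfiesDML (FIMod.SP R M),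
      FIMod.IsSemiprimeModule R M ∧ ExtremallyDisconnected (FIMod.Spec R M)] := by
  tfae_have 1 → 2 := fun ⟨hs, h⟩ =>
    ⟨hs.isFIRetractable, fun N L hN hL => (hs.ann_prod hN hL).trans (h N L hN hL)⟩
  tfae_have 2 → 3 := by
    rintro ⟨hr, h⟩
    have hsup : ∀ N : Submodule R M, N.IsFullyInvariant →
        FIMod.ann N ⊔ FIMod.ann (FIMod.ann N) = ⊤ := fun N hN => by
      -- Condition 2 is applied to the pair `ann N`, `N`, whose product is `⊥`.
      rw [sup_comm, ← h _ _ (FIMod.isFullyInvariant_ann N) hN, FIMod.prod_ann, FIMod.ann_bot]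
    exact ⟨hr, fun N hN => (hr.isSemiprimeModule hsup).isCompl_ann_ann (hsup N hN)⟩
  tfae_have 3 → 4 := fun ⟨hr, h⟩ =>
    ⟨hr, fun N hN => ⟨_, h N hN⟩, fun N hN L hL =>
      ⟨Submodule.isIdempotentElem_projection hL,
        FIMod.projection_mem_center (FIMod.isFullyInvariant_ann N)
          (FIMod.isFullyInvariant_ann _) (h N hN) hL⟩⟩
  tfae_have 4 → 1 := by
    rintro ⟨hr, hb, h⟩
    have hsup : ∀ N : Submodule R M, N.IsFullyInvariant →
        FIMod.ann N ⊔ FIMod.ann (FIMod.ann N) = ⊤ := fun N hN => by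
      obtain ⟨L, hL⟩ := hb N hN
      have hLf := FIMod.isFullyInvariant_of_projection_mem_center hL (h N hN L hL).2
      -- `L` is fully invariant and meets `ann N` trivially, so `L ≤ ann (ann N)` without
      -- semiprimeness.
      refine top_le_iff.1 (hL.sup_eq_top.ge.trans (sup_le_sup_left ?_ _))
      refine FIMod.prod_eq_bot_iff.1 (le_bot_iff.1 ((FIMod.prod_le_inf hLf _).trans ?_))
      rw [inf_comm, hL.inf_eq_bot]
    have hs := hr.isSemiprimeModule hsup
    exact ⟨hs, hs.satisfiesDML fun N hN => hs.isCompl_ann_ann (hsup N hN)⟩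
  tfae_have 1 → 5 := fun ⟨hs, h⟩ => ⟨hs, hs.frameSatisfiesDML h⟩
  tfae_have 5 → 3 := fun ⟨hs, h⟩ =>
    ⟨hs.isFIRetractable, fun N hN => hs.isCompl_ann_ann
      (hM.ann_sup_ann_ann_of_frameSatisfiesDML hs h hN)⟩
  tfae_have 3 → 6 := fun ⟨hr, h⟩ =>
    have hs := hr.isSemiprimeModule fun N hN => (h N hN).sup_eq_top
    ⟨hs, hM.extremallyDisconnected hs h⟩
  tfae_have 6 → 3 := fun ⟨hs, h⟩ =>
    ⟨hs.isFIRetractable, fun N hN => hs.isCompl_ann_ann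
      (hM.ann_sup_ann_ann_of_extremallyDisconnected hs h hN)⟩
  tfae_finish
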